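/- The Shannon game $(G,s,t)$ is played on a finite simple graph $G$ with two distinct vertices $s,t$ designated as terminals. Two players, Short and Cut, alternately colour a previously uncoloured non-terminal vertex until all non-terminal vertices are coloured; Short wins if there is a path from $s$ to $t$ all of whose non-terminal vertices were coloured by Short, and otherwise Cut wins. The game is a \emph{weak link} if each of the two players has a winning strategy when moving first. A weak link is \emph{minimal} if, for every edge $e$ of $G$, Short no longer has a winning strategy as first player in the game $(G-e,s,t)$. The \emph{weight} $w$ is the number of non-terminal vertices of $G$; a \emph{border vertex} is a neighbour of $s$ or of $t$; the \emph{centre} is the set of non-terminal vertices that are adjacent to neither $s$ nor $t$, and $p$ denotes its size. Let $(G,s,t)$ be a minimal weak link of weight $w$ whose centre has size $p$, and let $b$ be a border vertex of degree $d_b$ in $G$. If $w>3$, then $d_b\le p+2$. If $w>5$, then $d_b\le p+1$. -/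

import Mathlib

namespace ShannonGame

/-- The two players: `short` tries to join the terminals, `cut` tries to prevent this. -/
inductive Player where
  | short
  | cut

/-- The opponent of a player. -/
def Player.other : Player → Player
  | .short => .cut
  | .cut => .short

variable {V : Type*}

/-- A position of the game: `c x = some P` if player `P` has coloured (taken) the vertex `x`,
and `c x = none` if nobody has. -/
abbrev Position (V : Type*) := V → Option Player

/-- A vertex that may be played: not a terminal and not yet coloured. -/
def Playable (s t : V) (c : Position V) (x : V) : Prop :=
  x ≠ s ∧ x ≠ t ∧ c x = none

/-- There is a path between the terminals all of whose non-terminal vertices belong to `short`. -/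
def Joined (G : SimpleGraph V) (s t : V) (c : Position V) : Prop :=
  ∃ q : G.Walk s t, ∀ x ∈ q.support, x = s ∨ x = t ∨ c x = some Player.short

/-- The player who has won a completely coloured position. -/
def WonBy (G : SimpleGraph V) (s t : V) (c : Position V) : Player → Prop
  | .short => Joined G s t c
  | .cut => ¬ Joined G s t c

/-- `Forces G s t P Q c`: with player `Q` to move in the position `c`, player `P` has a strategy
that wins the rest of the game. The players alternately colour a playable vertex until none
is left. -/
inductive Forces [DecidableEq V] (G : SimpleGraph V) (s t : V) (P : Player) :
    Player → Position V → Prop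
  | finished (Q : Player) (c : Position V) (hfull : ∀ x, ¬ Playable s t c x)
      (hwon : WonBy G s t c P) : Forces G s t P Q c
  | ownMove (c : Position V) (x : V) (hx : Playable s t c x)
      (hnext : Forces G s t P P.other (Function.update c x (some P))) : Forces G s t P P c
  | otherMove (c : Position V) (hsome : ∃ x, Playable s t c x)
      (hnext : ∀ x, Playable s t c x →
        Forces G s t P P (Function.update c x (some P.other))) : Forces G s t P P.other c

/-- `P` has a winning strategy for the game `(G, s, t)` when moving first. -/
def WinsFirst [DecidableEq V] (G : SimpleGraph V) (s t : V) (P : Player) : Prop :=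
  Forces G s t P P (fun _ => none)

/-- A weak link: both players have a first-player winning strategy. -/
def IsWeakLink [DecidableEq V] (G : SimpleGraph V) (s t : V) : Prop :=
  WinsFirst G s t .short ∧ WinsFirst G s t .cut

/-- A minimal weak link: a weak link that is weakened by the deletion of any single edge, i.e.
after the deletion `short` no longer has a first-player winning strategy. -/
def IsMinimalWeakLink [DecidableEq V] (G : SimpleGraph V) (s t : V) : Prop :=
  IsWeakLink G s t ∧ ∀ e ∈ G.edgeSet, ¬ WinsFirst (G.deleteEdges {e}) s t .short

/-- The weight: the number of non-terminal vertices. -/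
def weight [Fintype V] [DecidableEq V] (s t : V) : ℕ :=
  (Finset.univ.filter fun x : V => x ≠ s ∧ x ≠ t).card

/-- A border vertex: a neighbour of a terminal. -/
def IsBorder (G : SimpleGraph V) (s t b : V) : Prop :=
  G.Adj s b ∨ G.Adj t b

/-- The size of the centre, the set of non-terminal vertices that are in neither border. -/
def centreSize [Fintype V] [DecidableEq V] (G : SimpleGraph V) [DecidableRel G.Adj]
    (s t : V) : ℕ :=
  (Finset.univ.filter fun x : V => x ≠ s ∧ x ≠ t ∧ ¬ G.Adj s x ∧ ¬ G.Adj t x).card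

end ShannonGame

/-!
Minimality means that `short` cannot win inside a proper part of the graph: whenever a strategy
only uses paths within a set `S` of vertices, every edge has both ends in `S`. Hence a double
threat after one move of `short` forces the weight to be small, and so does a double threat after
two moves the first of which `cut` had to answer at a fixed vertex.

If a border vertex `b` next to `s` has two neighbours next to `t`, its capture is such a double
threat. Otherwise the neighbours of `b` are `s`, at most one vertex `x` next to `t`, and vertices of
the centre, and the stronger bound can only fail if `x` exists and `b` is adjacent to the whole
centre.

In that case an exchange argument limits the weight. Suppose that `m` is a winning move of `short`
and that `r`, a terminal or a vertex of `short`, is adjacent to all neighbours of `m` but `r`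
itself and at most one further vertex `y`. If `cut` answers at `y`, then `r` serves every purpose of
`m`, so `short` need not take `m`: treating `m` and `y` as a pair of which `cut` gets at most one,
`short` wins without `m`, against minimality. Unless the weight is at most five, every winning
opening of `short` is of this kind, except `b` itself; after that opening and the forced answer at
`x`, every winning second move is.
-/

namespace ShannonGame

variable {V : Type*} {G G' : SimpleGraph V} {s t : V}

section Connection

theorem adj_spanningCoe_induce {S : Set V} {u v : V} :
    (G.induce S).spanningCoe.Adj u v ↔ G.Adj u v ∧ u ∈ S ∧ v ∈ S := by
  simp

theorem spanningCoe_induce_mono {S T : Set V} (hG : G ≤ G') (hST : S ⊆ T) :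
    (G.induce S).spanningCoe ≤ (G'.induce T).spanningCoe := by
  intro u v h
  rw [adj_spanningCoe_induce] at h ⊢
  exact ⟨hG h.1, hST h.2.1, hST h.2.2⟩

theorem reachable_map_of_forall_adj {V' : Type*} {H : SimpleGraph V'} (f : V → V')
    (hf : ∀ u v, G.Adj u v → H.Reachable (f u) (f v)) {u v : V} (h : G.Reachable u v) :
    H.Reachable (f u) (f v) := by
  rw [SimpleGraph.reachable_iff_reflTransGen] at h ⊢
  exact h.lift' f fun u v huv => (SimpleGraph.reachable_iff_reflTransGen _ _).1 (hf u v huv)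

theorem exists_walk_support_subset_iff {S : Set V} {u v : V} :
    (∃ q : G.Walk u v, ∀ x ∈ q.support, x ∈ S) ↔
      u ∈ S ∧ (G.induce S).spanningCoe.Reachable u v := by
  constructor
  · rintro ⟨q, hq⟩
    refine ⟨hq u q.start_mem_support, ?_⟩
    induction q with
    | nil => exact .rfl
    | cons huw q ih =>
      simp only [SimpleGraph.Walk.support_cons, List.forall_mem_cons] at hq
      exact (adj_spanningCoe_induce.2 ⟨huw, hq.1, hq.2 _ q.start_mem_support⟩).reachable.trans
        (ih hq.2)
  · rintro ⟨hu, ⟨q⟩⟩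
    induction q with
    | nil => exact ⟨.nil, by simpa using hu⟩
    | cons huw _ ih =>
      obtain ⟨hadj, -, hw⟩ := adj_spanningCoe_induce.1 huw
      obtain ⟨q, hq⟩ := ih hw
      exact ⟨.cons hadj q, by simpa using ⟨hu, hq⟩⟩

/-- The vertices that a path of `short` may use in the position `c`. -/
def usable (s t : V) (c : Position V) : Set V :=
  insert s (insert t {v | c v = some .short})

/-- The terminals are joined by a path whose inner vertices lie in `A`: the form in which threats
of `short` are recorded independently of a position. Terminals in `A` are harmless. -/
def Connects (G : SimpleGraph V) (s t : V) (A : Set V) : Prop :=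
  (G.induce (insert s (insert t A))).spanningCoe.Reachable s t

theorem connects_of_walk {A : Set V} (q : G.Walk s t)
    (hq : ∀ x ∈ q.support, x ∈ insert s (insert t A)) : Connects G s t A :=
  (exists_walk_support_subset_iff.1 ⟨q, hq⟩).2

theorem Connects.mono {A B : Set V} (hG : G ≤ G') (hAB : A ⊆ B) (h : Connects G s t A) :
    Connects G' s t B :=
  SimpleGraph.Reachable.mono
    (spanningCoe_induce_mono hG (Set.insert_subset_insert (Set.insert_subset_insert hAB))) h

theorem Connects.induce {A S : Set V} (hS : insert s (insert t A) ⊆ S) (h : Connects G s t A) :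
    Connects (G.induce S).spanningCoe s t A := by
  refine SimpleGraph.Reachable.mono (fun u v huv => ?_) h
  simp only [adj_spanningCoe_induce] at huv ⊢
  exact ⟨⟨huv.1, hS huv.2.1, hS huv.2.2⟩, huv.2⟩

theorem joined_iff_connects {c : Position V} :
    Joined G s t c ↔ Connects G s t {v | c v = some .short} :=
  exists_walk_support_subset_iff.trans (and_iff_right (Set.mem_insert _ _))

theorem Connects.joined {c : Position V} {A : Set V} (h : Connects G s t A)
    (hA : ∀ v ∈ A, c v = some .short) : Joined G s t c :=
  joined_iff_connects.2 (h.mono le_rfl hA)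

theorem Joined.mono {c c' : Position V} (h : Joined G s t c)
    (hc : ∀ v, c v = some .short → c' v = some .short) : Joined G s t c' :=
  (joined_iff_connects.1 h).joined hc

theorem Joined.swap {c : Position V} (h : Joined G s t c) : Joined G t s c := by
  rw [joined_iff_connects, Connects] at h ⊢
  rw [Set.insert_comm]
  exact h.symm

/-- Paths through `m` are rerouted through `r`: the map that sends `m` to `r` and fixes all other
vertices takes adjacent usable vertices to connected ones. -/
theorem Joined.bypass {c c' : Position V} {m r : V} (h : Joined G s t c) (hms : m ≠ s)
    (hmt : m ≠ t) (hrm : r ≠ m) (hr : r ∈ usable s t c)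
    (hreach : ∀ v ∈ usable s t c, G.Adj m v → v = r ∨ G.Adj r v)
    (hc : ∀ v, v ≠ m → c v = some .short → c' v = some .short) :
    Joined (G.induce {m}ᶜ).spanningCoe s t c' := by
  classical
  let H := ((G.induce {m}ᶜ).spanningCoe.induce (usable s t c')).spanningCoe
  have hadj : ∀ u v, G.Adj u v → u ≠ m → v ≠ m → u ∈ usable s t c → v ∈ usable s t c →
      H.Adj u v := by
    intro u v huv hum hvm hu hv
    have huse : ∀ w ≠ m, w ∈ usable s t c → w ∈ usable s t c' :=
      fun w hwm hw => hw.imp id (Or.imp id (hc w hwm))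
    simp only [H, adj_spanningCoe_induce]
    exact ⟨⟨huv, hum, hvm⟩, huse u hum hu, huse v hvm hv⟩
  have hnear : ∀ v ∈ usable s t c, G.Adj m v → H.Reachable r v := by
    intro v hv hmv
    obtain rfl | hrv := hreach v hv hmv
    · exact .rfl
    · exact (hadj r v hrv hrm hmv.ne' hr hv).reachable
  rw [joined_iff_connects] at h ⊢
  suffices hmap : H.Reachable (Function.update id m r s) (Function.update id m r t) by
    rwa [Function.update_of_ne hms.symm, Function.update_of_ne hmt.symm] at hmap
  refine reachable_map_of_forall_adj _ (fun u v huv => ?_) h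
  obtain ⟨huv, hu, hv⟩ := adj_spanningCoe_induce.1 huv
  obtain rfl | hum := eq_or_ne u m
  · rw [Function.update_self, Function.update_of_ne huv.ne']
    exact hnear v hv huv
  obtain rfl | hvm := eq_or_ne v m
  · rw [Function.update_self, Function.update_of_ne hum]
    exact (hnear u hu huv.symm).symm
  · rw [Function.update_of_ne hum, Function.update_of_ne hvm]
    exact (hadj u v huv hum hvm hu hv).reachable

theorem Joined.deleteEdge {c : Position V} {p q : V} (h : Joined G s t c)
    (hpq : p ∈ usable s t c → q ∈ usable s t c →
      ((G.deleteEdges {s(p, q)}).induce (usable s t c)).spanningCoe.Reachable p q) :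
    Joined (G.deleteEdges {s(p, q)}) s t c := by
  rw [joined_iff_connects] at h ⊢
  refine reachable_map_of_forall_adj id (fun u v huv => ?_) h
  obtain ⟨huv, hu, hv⟩ := adj_spanningCoe_induce.1 huv
  by_cases heq : s(u, v) = s(p, q)
  · obtain ⟨rfl, rfl⟩ | ⟨rfl, rfl⟩ := Sym2.eq_iff.1 heq
    exacts [hpq hu hv, (hpq hv hu).symm]
  · have hdel : (G.deleteEdges {s(p, q)}).Adj u v := by
      simpa only [SimpleGraph.deleteEdges_adj] using ⟨huv, heq⟩
    exact (adj_spanningCoe_induce.2 ⟨hdel, hu, hv⟩).reachable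

end Connection

section Exchange

/-- The neighbours of `m` that are lost to paths if `m` is replaced by `r`. -/
def privateNeighbors (G : SimpleGraph V) (m r : V) : Set V :=
  {v | G.Adj m v ∧ v ≠ r ∧ ¬ G.Adj r v}

/-- The position `c'` differs from `c` only in the exchange of `m` against `y`: in `c` it has been
played and `y` is lost for `short`, who may use `r`; in `c'` the vertices `m` and `y` are either
both uncoloured or coloured arbitrarily. -/
structure IsExchange (s t m y r : V) (c c' : Position V) : Prop where
  coloured : c m ≠ none
  lost : c y = some .cut
  mem_usable : r ∈ usable s t c
  agree : ∀ v, v ≠ m → v ≠ y → c' v = c v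
  free_iff : c' m = none ↔ c' y = none

theorem IsExchange.ne_of_eq_none {c c' : Position V} {m y r x : V}
    (h : IsExchange s t m y r c c') (hx : c x = none) : x ≠ m ∧ x ≠ y := by
  constructor
  · rintro rfl
    exact h.coloured hx
  · rintro rfl
    simp [h.lost] at hx

theorem IsExchange.joined {c c' : Position V} {m y r : V} (h : IsExchange s t m y r c c')
    (hms : m ≠ s) (hmt : m ≠ t) (hys : y ≠ s) (hyt : y ≠ t) (hrm : r ≠ m)
    (hprivate : privateNeighbors G m r ⊆ {y}) (hj : Joined G s t c) :
    Joined (G.induce {m}ᶜ).spanningCoe s t c' := by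
  refine hj.bypass hms hmt hrm h.mem_usable (fun v hv hmv => ?_) fun v hvm hv => ?_
  · by_contra! hvr
    obtain rfl : v = y := hprivate ⟨hmv, hvr⟩
    simp [usable, hys, hyt, h.lost] at hv
  · rwa [h.agree v hvm (by rintro rfl; simp [h.lost] at hv)]

end Exchange

section Strategies

variable [DecidableEq V] {P Q : Player} {c c' : Position V}

theorem update_of_ne_none {x v : V} {o : Option Player} (hx : c x = none) (hv : c v ≠ none) :
    Function.update c x o v = c v := by
  rw [Function.update_of_ne]
  rintro rfl
  exact hv hx

theorem Forces.swap (h : Forces G s t P Q c) : Forces G t s P Q c := by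
  induction h with
  | finished Q c hfull hwon =>
    refine .finished Q c (fun x hx => hfull x ⟨hx.2.1, hx.1, hx.2.2⟩) ?_
    cases P
    exacts [Joined.swap hwon, fun h => hwon h.swap]
  | ownMove c x hx _ ih => exact .ownMove c x ⟨hx.2.1, hx.1, hx.2.2⟩ ih
  | otherMove c hsome _ ih =>
    exact .otherMove c (hsome.imp fun _ hx => ⟨hx.2.1, hx.1, hx.2.2⟩)
      fun x hx => ih x ⟨hx.2.1, hx.1, hx.2.2⟩

theorem Forces.exists_wonBy (h : Forces G s t P Q c) : ∃ c', WonBy G s t c' P := by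
  induction h with
  | finished _ c _ hwon => exact ⟨c, hwon⟩
  | ownMove _ _ _ _ ih => exact ih
  | otherMove _ hsome _ ih => exact hsome.elim fun x hx => ih x hx

theorem Forces.mono (h : Forces G s t .short Q c)
    (hjoin : ∀ c', (∀ v, c v ≠ none → c' v = c v) → Joined G s t c' → Joined G' s t c') :
    Forces G' s t .short Q c := by
  have hstep : ∀ (c c' : Position V) (x : V) (P : Player), c x = none →
      (∀ v, Function.update c x (some P) v ≠ none → c' v = Function.update c x (some P) v) →
      ∀ v, c v ≠ none → c' v = c v := by
    intro c c' x P hx hc' v hv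
    rw [← update_of_ne_none hx hv]
    exact hc' v (by rwa [update_of_ne_none hx hv])
  induction h with
  | finished Q c hfull hwon => exact .finished Q c hfull (hjoin c (fun _ _ => rfl) hwon)
  | ownMove c x hx _ ih =>
    exact .ownMove c x hx (ih fun c' hc' => hjoin c' (hstep c c' x _ hx.2.2 hc'))
  | otherMove c hsome _ ih =>
    exact .otherMove c hsome fun x hx => ih x hx fun c' hc' =>
      hjoin c' (hstep c c' x _ hx.2.2 hc')

theorem WinsFirst.mono (hG : G ≤ G') (h : WinsFirst G s t .short) : WinsFirst G' s t .short :=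
  Forces.mono h fun _ _ hj => joined_iff_connects.2 ((joined_iff_connects.1 hj).mono hG le_rfl)

theorem Forces.reply (h : Forces G s t .short .cut c) {z : V} (hz : Playable s t c z) :
    Forces G s t .short .short (Function.update c z (some .cut)) := by
  generalize hQ : Player.cut = Q at h
  cases h with
  | finished _ _ hfull _ => exact absurd hz (hfull z)
  | ownMove => cases hQ
  | otherMove _ _ hnext => exact hnext z hz

/-- The vertex `m` may be taken by `short` in the position `c`, and `short` wins the rest of the
game if it is. -/
def IsWinningMove (G : SimpleGraph V) (s t : V) (c : Position V) (m : V) : Prop :=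
  Playable s t c m ∧ Forces G s t .short .cut (Function.update c m (some .short))

theorem Forces.exists_isWinningMove (h : Forces G s t .short .short c)
    (hc : ∃ z, Playable s t c z) : ∃ m, IsWinningMove G s t c m := by
  suffices ∀ Q, Q = .short → Forces G s t .short Q c → ∃ m, IsWinningMove G s t c m from
    this _ rfl h
  intro Q hQ h
  cases h with
  | finished _ _ hfull _ => exact absurd hc (not_exists.2 hfull)
  | ownMove _ x hx hnext => exact ⟨x, hx, hnext⟩
  | otherMove => cases hQ

/-- A vertex that is not yet lost to `cut` and whose capture by `short` joins the terminals. -/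
def IsThreat (G : SimpleGraph V) (s t : V) (c : Position V) (u : V) : Prop :=
  c u ≠ some .cut ∧ Joined G s t (Function.update c u (some .short))

theorem Connects.isThreat {A : Set V} {u : V} (h : Connects G s t A)
    (hA : ∀ v ∈ A, v = u ∨ c v = some .short) (hu : c u ≠ some .cut) : IsThreat G s t c u := by
  refine ⟨hu, h.joined fun v hv => ?_⟩
  obtain rfl | hvu := eq_or_ne v u
  · exact Function.update_self ..
  · rw [Function.update_of_ne hvu]
    exact (hA v hv).resolve_left hvu

theorem IsThreat.joined_or_playable {u : V} (h : IsThreat G s t c u) :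
    Joined G s t c ∨ Playable s t c u := by
  by_cases hu : Playable s t c u
  · exact .inr hu
  refine .inl ?_
  obtain ⟨q, hq⟩ := h.2
  refine ⟨q, fun v hv => ?_⟩
  obtain rfl | hvu := eq_or_ne v u
  · by_contra! hv'
    rcases hcv : c v with - | - | -
    exacts [hu ⟨hv'.1, hv'.2.1, hcv⟩, hv'.2.2 hcv, h.1 hcv]
  · simpa only [Function.update_of_ne hvu] using hq v hv

theorem IsThreat.update_cut {u v : V} (h : IsThreat G s t c u) (huv : u ≠ v) (hv : c v = none) :
    IsThreat G s t (Function.update c v (some .cut)) u := by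
  refine ⟨by rw [Function.update_of_ne huv]; exact h.1, h.2.mono fun w hw => ?_⟩
  obtain rfl | hwu := eq_or_ne w u
  · exact Function.update_self ..
  · rw [Function.update_of_ne hwu] at hw ⊢
    rwa [update_of_ne_none hv (by simp [hw])]

/-- The position after `short` has taken `b` and `cut` has been forced to answer at `x`. -/
def forcedPosition (b x : V) : Position V :=
  Function.update (Function.update (fun _ => none) b (some .short)) x (some .cut)

theorem forcedPosition_eq_none {b x v : V} :
    forcedPosition b x v = none ↔ v ≠ x ∧ v ≠ b := by
  simp only [forcedPosition, Function.update_apply]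
  grind

theorem forcedPosition_eq_short {b x v : V} :
    forcedPosition b x v = some .short ↔ v = b ∧ b ≠ x := by
  simp only [forcedPosition, Function.update_apply]
  grind

theorem IsExchange.update {m y r x : V} (h : IsExchange s t m y r c c')
    (hx : c x = none) :
    IsExchange s t m y r (Function.update c x (some P)) (Function.update c' x (some P)) := by
  obtain ⟨hxm, hxy⟩ := h.ne_of_eq_none hx
  refine ⟨?_, ?_, h.mem_usable.imp id (Or.imp id fun hr => ?_), fun v hvm hvy => ?_, ?_⟩
  · rw [Function.update_of_ne hxm.symm]
    exact h.coloured
  · rw [Function.update_of_ne hxy.symm]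
    exact h.lost
  · rw [Set.mem_ofPred_eq] at hr ⊢
    rwa [update_of_ne_none hx (by simp [hr])]
  · simp only [Function.update_apply, h.agree v hvm hvy]
  · rw [Function.update_of_ne hxm.symm, Function.update_of_ne hxy.symm]
    exact h.free_iff

theorem IsExchange.fill {m y r : V} (h : IsExchange s t m y r c c') (hmy : m ≠ y)
    (P Q : Player) :
    IsExchange s t m y r c (Function.update (Function.update c' m (some P)) y (some Q)) := by
  refine { h with agree := fun v hvm hvy => ?_, free_iff := ?_ }
  · rw [Function.update_of_ne hvy, Function.update_of_ne hvm, h.agree v hvm hvy]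
  · simp [hmy]

variable [Finite V]

theorem position_induction {motive : Position V → Prop}
    (h : ∀ c, (∀ x P, c x = none → motive (Function.update c x (some P))) → motive c)
    (c : Position V) : motive c := by
  induction hS : {v | c v = none} using WellFoundedLT.induction generalizing c with
  | ind S ih =>
    refine h c fun x P hx => ih _ ?_ _ rfl
    subst hS
    refine (Set.ssubset_iff_of_subset fun v hv => ?_).2 ⟨x, hx, by simp⟩
    by_contra hcv
    rw [Set.mem_ofPred_eq, update_of_ne_none hx hcv] at hv
    exact hcv hv

theorem forces_of_joined (Q : Player) (h : Joined G s t c) : Forces G s t .short Q c := by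
  induction c using position_induction generalizing Q with
  | h c ih =>
    by_cases hfull : ∀ x, ¬ Playable s t c x
    · exact .finished Q c hfull h
    have hnext : ∀ x, Playable s t c x → ∀ P Q,
        Forces G s t .short Q (Function.update c x (some P)) := by
      refine fun x hx P Q => ih x P hx.2.2 Q (h.mono fun v hv => ?_)
      rwa [update_of_ne_none hx.2.2 (by simp [hv])]
    push Not at hfull
    cases Q
    · obtain ⟨x, hx⟩ := hfull
      exact .ownMove c x hx (hnext x hx _ _)
    · exact .otherMove c hfull fun x hx => hnext x hx _ _

theorem IsThreat.forces {u : V} (h : IsThreat G s t c u) : Forces G s t .short .short c := by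
  obtain hj | hu := h.joined_or_playable
  exacts [forces_of_joined _ hj, .ownMove c u hu (forces_of_joined _ h.2)]

theorem IsThreat.forces_of_answer {u : V} (h : IsThreat G s t c u)
    (hanswer : Forces G s t .short .short (Function.update c u (some .cut))) :
    Forces G s t .short .cut c := by
  obtain hj | hu := h.joined_or_playable
  · exact forces_of_joined _ hj
  refine .otherMove c ⟨u, hu⟩ fun z hz => ?_
  obtain rfl | huz := eq_or_ne u z
  exacts [hanswer, (h.update_cut huz hz.2.2).forces]

theorem IsThreat.forces_of_ne {u v : V} (hu : IsThreat G s t c u) (hv : IsThreat G s t c v)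
    (huv : u ≠ v) : Forces G s t .short .cut c := by
  obtain hj | hpu := hu.joined_or_playable
  exacts [forces_of_joined _ hj, hu.forces_of_answer (hv.update_cut huv.symm hpu.2.2).forces]

theorem winsFirst_of_adj_of_adj {u : V} (hsu : G.Adj s u) (htu : G.Adj t u) :
    WinsFirst G s t .short :=
  .ownMove _ u ⟨hsu.ne', htu.ne', rfl⟩ <| forces_of_joined _ <|
    (connects_of_walk (A := {u}) (.cons hsu (.cons htu.symm .nil)) (by simp)).joined (by simp)

theorem winsFirst_of_fork {d u v : V} (hds : d ≠ s) (hdt : d ≠ t) (huv : u ≠ v)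
    (hu : Connects G s t {d, u}) (hv : Connects G s t {d, v}) : WinsFirst G s t .short := by
  have hthreat : ∀ w, Connects G s t {d, w} →
      IsThreat G s t (Function.update (fun _ => none) d (some .short)) w :=
    fun w hw => hw.isThreat (by simp [or_comm]) (by simp [Function.update_apply])
  exact .ownMove _ d ⟨hds, hdt, rfl⟩ ((hthreat u hu).forces_of_ne (hthreat v hv) huv)

theorem winsFirst_of_forces_forcedPosition {b x : V} (hbs : b ≠ s) (hbt : b ≠ t) (hbx : b ≠ x)
    (hx : Connects G s t {b, x}) (h : Forces G s t .short .short (forcedPosition b x)) :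
    WinsFirst G s t .short := by
  refine .ownMove _ b ⟨hbs, hbt, rfl⟩ (IsThreat.forces_of_answer (u := x) ?_ h)
  exact hx.isThreat (by simp [or_comm]) (by simp [hbx.symm])

theorem winsFirst_of_delayed_fork {b x d u v : V} (hbs : b ≠ s) (hbt : b ≠ t) (hds : d ≠ s)
    (hdt : d ≠ t) (hdb : d ≠ b) (hbx : b ≠ x) (hdx : d ≠ x) (hux : u ≠ x) (hvx : v ≠ x)
    (huv : u ≠ v) (hx : Connects G s t {b, x}) (hu : Connects G s t {b, d, u})
    (hv : Connects G s t {b, d, v}) : WinsFirst G s t .short := by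
  have hthreat : ∀ w, w ≠ x → Connects G s t {b, d, w} →
      IsThreat G s t (Function.update (forcedPosition b x) d (some .short)) w := by
    refine fun w hwx hw => hw.isThreat ?_ ?_
    · simp [forcedPosition_eq_short, hdb.symm, hbx]
    · simp only [forcedPosition, Function.update_apply, if_neg hwx]
      split_ifs <;> simp
  exact winsFirst_of_forces_forcedPosition hbs hbt hbx hx
    (.ownMove _ d ⟨hds, hdt, forcedPosition_eq_none.2 ⟨hdx, hdb⟩⟩
      ((hthreat u hux hu).forces_of_ne (hthreat v hvx hv) huv))

/-- While `m` and `y` are still uncoloured in `c'`, `short` answers a move of `cut` on one of them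
on the other. -/
theorem Forces.bypass {m y r : V} (hms : m ≠ s) (hmt : m ≠ t) (hys : y ≠ s) (hyt : y ≠ t)
    (hmy : m ≠ y) (hrm : r ≠ m) (hprivate : privateNeighbors G m r ⊆ {y})
    (h : Forces G s t .short Q c) (hex : IsExchange s t m y r c c') :
    Forces (G.induce {m}ᶜ).spanningCoe s t .short Q c' := by
  induction h generalizing c' with
  | finished Q c _ hwon => exact forces_of_joined Q (hex.joined hms hmt hys hyt hrm hprivate hwon)
  | ownMove c x hx _ ih =>
    obtain ⟨hxm, hxy⟩ := hex.ne_of_eq_none hx.2.2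
    exact .ownMove c' x ⟨hx.1, hx.2.1, (hex.agree x hxm hxy).trans hx.2.2⟩ (ih (hex.update hx.2.2))
  | otherMove c hsome _ ih =>
    have hoff : ∀ {c'} x, IsExchange s t m y r c c' → Playable s t c' x → x ≠ m → x ≠ y →
        Forces (G.induce {m}ᶜ).spanningCoe s t .short .short
          (Function.update c' x (some .cut)) := by
      intro c' x hex hx hxm hxy
      have hcx : c x = none := (hex.agree x hxm hxy).symm.trans hx.2.2
      exact ih x ⟨hx.1, hx.2.1, hcx⟩ (hex.update hcx)
    have hfilled : ∀ {c'}, IsExchange s t m y r c c' → c' m ≠ none →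
        Forces (G.induce {m}ᶜ).spanningCoe s t .short .cut c' := by
      intro c' hex hm
      refine .otherMove c' (hsome.imp fun x hx => ⟨hx.1, hx.2.1, ?_⟩) fun x hx =>
        hoff x hex hx (by rintro rfl; exact hm hx.2.2)
          (by rintro rfl; exact hm (hex.free_iff.2 hx.2.2))
      obtain ⟨hxm, hxy⟩ := hex.ne_of_eq_none hx.2.2
      exact (hex.agree x hxm hxy).trans hx.2.2
    by_cases hm : c' m = none
    swap
    · exact hfilled hex hm
    have hy : c' y = none := hex.free_iff.1 hm
    refine .otherMove c' ⟨m, hms, hmt, hm⟩ fun x hx => ?_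
    obtain rfl | hxm := eq_or_ne x m
    · refine .ownMove _ y ⟨hys, hyt, by rwa [Function.update_of_ne hmy.symm]⟩
        (hfilled (hex.fill hmy _ _) (by simp [hmy]))
    obtain rfl | hxy := eq_or_ne x y
    · refine .ownMove _ m ⟨hms, hmt, by rwa [Function.update_of_ne hmy]⟩ ?_
      rw [Function.update_comm hxm]
      exact hfilled (hex.fill hmy _ _) (by simp [hmy])
    exact hoff x hex hx hxm hxy

theorem IsWinningMove.forces_induce_compl {m r : V} (hm : IsWinningMove G s t c m)
    (hfree : ∃ u ≠ m, Playable s t c u) (hr : r ∈ usable s t c)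
    (hplay : ∀ v ∈ privateNeighbors G m r, Playable s t c v)
    (huniq : (privateNeighbors G m r).Subsingleton) :
    Forces (G.induce {m}ᶜ).spanningCoe s t .short .short c := by
  obtain ⟨hms, hmt, hcm⟩ := hm.1
  have hrm : r ≠ m := by
    rintro rfl
    simp [usable, hms, hmt, hcm] at hr
  obtain ⟨y, hym, hy, hprivate⟩ :
      ∃ y ≠ m, Playable s t c y ∧ privateNeighbors G m r ⊆ {y} := by
    obtain hempty | ⟨y, hprivate⟩ := huniq.eq_empty_or_singleton
    · exact hfree.imp fun u hu => ⟨hu.1, hu.2, hempty ▸ Set.empty_subset _⟩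
    · have hy : y ∈ privateNeighbors G m r := hprivate ▸ rfl
      exact ⟨y, hy.1.ne', hplay y hy, hprivate.subset⟩
  obtain ⟨hys, hyt, hcy⟩ := hy
  have hcmy : Function.update c m (some .short) y = none := by rwa [Function.update_of_ne hym]
  refine (hm.2.reply ⟨hys, hyt, hcmy⟩).bypass hms hmt hys hyt hym.symm hrm hprivate
    ⟨?_, Function.update_self .., hr.imp id (Or.imp id fun hr => ?_), fun v hvm hvy => ?_,
      iff_of_true hcm hcy⟩
  · simp [Function.update_of_ne hym.symm]
  · rw [Set.mem_ofPred_eq] at hr ⊢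
    have hry : r ≠ y := by
      rintro rfl
      simp [hr] at hcy
    rwa [Function.update_of_ne hry, Function.update_of_ne hrm]
  · rw [Function.update_of_ne hvy, Function.update_of_ne hvm]

end Strategies

section Minimality

/-- A vertex of the centre. -/
def IsCentre (G : SimpleGraph V) (s t v : V) : Prop :=
  v ≠ s ∧ v ≠ t ∧ ¬ G.Adj s v ∧ ¬ G.Adj t v

variable [DecidableEq V]

namespace IsMinimalWeakLink

theorem swap (hG : IsMinimalWeakLink G s t) : IsMinimalWeakLink G t s :=
  ⟨⟨Forces.swap hG.1.1, Forces.swap hG.1.2⟩, fun e he hw => hG.2 e he (Forces.swap hw)⟩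

theorem eq_of_le (hG : IsMinimalWeakLink G s t) (hle : G' ≤ G)
    (hw : WinsFirst G' s t .short) : G' = G := by
  refine hle.antisymm fun u v huv => ?_
  by_contra huv'
  refine hG.2 s(u, v) huv (hw.mono fun p q hpq => ?_)
  refine SimpleGraph.deleteEdges_adj.2 ⟨hle hpq, fun heq => huv' ?_⟩
  rwa [← SimpleGraph.mem_edgeSet, ← Set.mem_singleton_iff.1 heq, SimpleGraph.mem_edgeSet]

theorem support_subset (hG : IsMinimalWeakLink G s t) {S : Set V}
    (hw : WinsFirst (G.induce S).spanningCoe s t .short) : G.support ⊆ S :=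
  (G.spanningCoe_induce_eq_self S).1 (hG.eq_of_le (G.spanningCoe_induce_le S) hw)

theorem not_adj_terminals (hG : IsMinimalWeakLink G s t) : ¬ G.Adj s t := by
  intro hst
  obtain ⟨c, hc⟩ := Forces.exists_wonBy hG.1.2
  exact hc ⟨.cons hst .nil, by simp⟩

theorem ne_of_adj (hG : IsMinimalWeakLink G s t) {v : V} (h : G.Adj s v) : v ≠ t := by
  rintro rfl
  exact hG.not_adj_terminals h

theorem not_adj_of_walk (hG : IsMinimalWeakLink G s t) {m p q : V}
    (hm : IsWinningMove G s t (fun _ => none) m) (w : G.Walk p q) (hedges : s(p, q) ∉ w.edges)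
    (hsupport : ∀ v ∈ w.support, v ∈ ({s, t, m, p, q} : Set V)) : ¬ G.Adj p q := by
  intro hpq
  refine hG.2 s(p, q) hpq (.ownMove _ m hm.1 (hm.2.mono fun c hc hj => hj.deleteEdge ?_))
  intro hp hq
  refine (exists_walk_support_subset_iff.1 ⟨w.toDeleteEdge _ hedges, fun v hv => ?_⟩).2
  have hcm : c m = some .short := by simpa using hc m (by simp)
  rw [SimpleGraph.Walk.support_transfer] at hv
  obtain rfl | rfl | rfl | rfl | rfl := hsupport v hv
  exacts [.inl rfl, .inr (.inl rfl), .inr (.inr hcm), hp, hq]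

theorem not_adj_of_common_neighbor (hG : IsMinimalWeakLink G s t) {m k p q : V}
    (hm : IsWinningMove G s t (fun _ => none) m) (hk : k = s ∨ k = t ∨ k = m)
    (hkp : G.Adj k p) (hkq : G.Adj k q) : ¬ G.Adj p q := by
  refine hG.not_adj_of_walk hm (.cons hkp.symm (.cons hkq .nil)) ?_ ?_
  · simp [hkp.ne', hkq.ne']
  · intro v hv
    obtain rfl | rfl | rfl : v = p ∨ v = k ∨ v = q := by simpa using hv
    exacts [by simp, by grind, by simp]

theorem not_adj_of_square (hG : IsMinimalWeakLink G s t) {m p q : V}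
    (hm : IsWinningMove G s t (fun _ => none) m) (hsm : G.Adj s m) (hsp : G.Adj s p)
    (hmq : G.Adj m q) (hpm : p ≠ m) (hqs : q ≠ s) : ¬ G.Adj p q := by
  refine hG.not_adj_of_walk hm (.cons hsp.symm (.cons hsm (.cons hmq .nil))) ?_ (by simp)
  simp [hqs, hpm, hsp.ne', hmq.ne']

theorem exists_isWinningMove (hG : IsMinimalWeakLink G s t) {v : V} (hvs : v ≠ s)
    (hvt : v ≠ t) : ∃ m, IsWinningMove G s t (fun _ => none) m :=
  Forces.exists_isWinningMove hG.1.1 ⟨v, hvs, hvt, rfl⟩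

theorem isCentre_of_adj (hG : IsMinimalWeakLink G s t) {b v : V} (hsb : G.Adj s b)
    (htb : ¬ G.Adj t b) (hbv : G.Adj b v) (hvs : v ≠ s) (htv : ¬ G.Adj t v) : IsCentre G s t v := by
  refine ⟨hvs, ?_, fun hsv => ?_, htv⟩
  · rintro rfl
    exact htb hbv.symm
  · obtain ⟨m, hm⟩ := hG.exists_isWinningMove hsb.ne' (hG.ne_of_adj hsb)
    exact hG.not_adj_of_common_neighbor hm (.inl rfl) hsb hsv hbv

variable [Finite V]

theorem support_subset_of_adj_of_adj (hG : IsMinimalWeakLink G s t) {u : V} (hsu : G.Adj s u)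
    (htu : G.Adj t u) : G.support ⊆ {s, t, u} :=
  hG.support_subset <| winsFirst_of_adj_of_adj (u := u) (by simp [hsu]) (by simp [htu])

theorem support_subset_of_fork (hG : IsMinimalWeakLink G s t) {d u v : V} (hds : d ≠ s)
    (hdt : d ≠ t) (huv : u ≠ v) (hu : Connects G s t {d, u}) (hv : Connects G s t {d, v}) :
    G.support ⊆ {s, t, d, u, v} :=
  hG.support_subset <| winsFirst_of_fork hds hdt huv (hu.induce (by grind)) (hv.induce (by grind))

theorem support_subset_of_delayed_fork (hG : IsMinimalWeakLink G s t) {b x d u v : V}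
    (hbs : b ≠ s) (hbt : b ≠ t) (hds : d ≠ s) (hdt : d ≠ t) (hdb : d ≠ b) (hbx : b ≠ x)
    (hdx : d ≠ x) (hux : u ≠ x) (hvx : v ≠ x) (huv : u ≠ v) (hx : Connects G s t {b, x})
    (hu : Connects G s t {b, d, u}) (hv : Connects G s t {b, d, v}) :
    G.support ⊆ {s, t, b, x, d, u, v} :=
  hG.support_subset <| winsFirst_of_delayed_fork hbs hbt hds hdt hdb hbx hdx hux hvx huv
    (hx.induce (by grind)) (hu.induce (by grind)) (hv.induce (by grind))

end IsMinimalWeakLink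

end Minimality

section TightBorder

variable [DecidableEq V] {b x : V}

theorem exists_nonterminal_notMem [Fintype V] {T : Finset V} (hT : T.card < weight s t) :
    ∃ u ∉ T, u ≠ s ∧ u ≠ t := by
  obtain ⟨u, hu, huT⟩ := Finset.exists_mem_notMem_of_card_lt_card hT
  exact ⟨u, huT, (Finset.mem_filter.1 hu).2⟩

/-- A border vertex `b` next to `s` that is adjacent to the whole centre and to a vertex `x` of the
opposite border, so that its degree may exceed the size of the centre by two. -/
structure IsTightBorder (G : SimpleGraph V) (s t b x : V) : Prop where
  minimal : IsMinimalWeakLink G s t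
  adj_left : G.Adj s b
  adj_mate : G.Adj b x
  mate_adj : G.Adj t x
  adj_centre : ∀ v, IsCentre G s t v → G.Adj b v

namespace IsTightBorder

variable {a c m r v v' y y' : V}

theorem left_ne (h : IsTightBorder G s t b x) (ha : G.Adj s a) : a ≠ t :=
  h.minimal.ne_of_adj ha

theorem right_ne (h : IsTightBorder G s t b x) (hy : G.Adj t y) : y ≠ s :=
  h.minimal.swap.ne_of_adj hy

theorem connects_mate (h : IsTightBorder G s t b x) : Connects G s t {b, x} :=
  connects_of_walk (.cons h.adj_left (.cons h.adj_mate (.cons h.mate_adj.symm .nil))) (by simp)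

theorem mem_support (h : IsTightBorder G s t b x) (hvs : v ≠ s) (hvt : v ≠ t) :
    v ∈ G.support := by
  by_cases hv : IsCentre G s t v
  · exact ⟨b, (h.adj_centre v hv).symm⟩
  · by_contra hsupp
    refine hv ⟨hvs, hvt, fun hsv => hsupp ⟨s, hsv.symm⟩, fun htv => hsupp ⟨t, htv.symm⟩⟩

theorem not_winsFirst_induce_compl (h : IsTightBorder G s t b x) (hms : m ≠ s) (hmt : m ≠ t) :
    ¬ WinsFirst (G.induce {m}ᶜ).spanningCoe s t .short :=
  fun hw => h.minimal.support_subset hw (h.mem_support hms hmt) rfl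

theorem not_adj_centre_of_left (h : IsTightBorder G s t b x)
    (hm : IsWinningMove G s t (fun _ => none) m) (hmab : m = a ∨ m = b) (ha : G.Adj s a)
    (hab : a ≠ b) (hv : IsCentre G s t v) : ¬ G.Adj a v := by
  intro hav
  have hbv := h.adj_centre v hv
  obtain rfl | rfl := hmab
  · exact h.minimal.not_adj_of_square hm ha h.adj_left hav hab.symm hv.1 hbv
  · exact h.minimal.not_adj_of_square hm h.adj_left ha hbv hab hv.1 hav

variable [Fintype V]

theorem not_support_subset (h : IsTightBorder G s t b x) {T : Finset V}
    (hT : T.card < weight s t) : ¬ G.support ⊆ insert s (insert t (T : Set V)) := by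
  intro hsupp
  obtain ⟨u, huT, hus, hut⟩ := exists_nonterminal_notMem hT
  obtain hu | hu | hu := hsupp (h.mem_support hus hut)
  exacts [hus hu, hut hu, huT hu]

theorem not_adj_right_of_adj_left (h : IsTightBorder G s t b x) (hw : 1 < weight s t)
    (hsv : G.Adj s v) : ¬ G.Adj t v := fun htv =>
  h.not_support_subset (T := {v}) (by simpa using hw) (by
    simpa using h.minimal.support_subset_of_adj_of_adj hsv htv)

theorem right_unique_of_left (h : IsTightBorder G s t b x) (hw : 3 < weight s t) (ha : G.Adj s a)
    (hy : G.Adj t y) (hy' : G.Adj t y') (hay : G.Adj a y) (hay' : G.Adj a y') : y = y' := by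
  by_contra hne
  have hconn : ∀ z, G.Adj t z → G.Adj a z → Connects G s t {a, z} := fun z hz haz =>
    connects_of_walk (.cons ha (.cons haz (.cons hz.symm .nil))) (by simp)
  have hsupp := h.minimal.support_subset_of_fork ha.ne' (h.left_ne ha) hne (hconn y hy hay)
    (hconn y' hy' hay')
  exact h.not_support_subset (T := {a, y, y'}) (Finset.card_le_three.trans_lt hw)
    (by simpa using hsupp)

theorem left_unique_of_right (h : IsTightBorder G s t b x) (hw : 3 < weight s t) (hy : G.Adj t y)
    (ha : G.Adj s v) (ha' : G.Adj s v') (hya : G.Adj y v) (hya' : G.Adj y v') : v = v' := by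
  by_contra hne
  have hconn : ∀ z, G.Adj s z → G.Adj y z → Connects G s t {y, z} := fun z hz hyz =>
    connects_of_walk (.cons hz (.cons hyz.symm (.cons hy.symm .nil))) (by simp)
  have hsupp := h.minimal.support_subset_of_fork (h.right_ne hy) hy.ne' hne (hconn v ha hya)
    (hconn v' ha' hya')
  exact h.not_support_subset (T := {y, v, v'}) (Finset.card_le_three.trans_lt hw)
    (by simpa using hsupp)

theorem eq_of_delayed_fork (h : IsTightBorder G s t b x) (hw : 5 < weight s t) (hcs : c ≠ s)
    (hct : c ≠ t) (hcb : c ≠ b) (hcx : c ≠ x) (hvx : v ≠ x) (hvx' : v' ≠ x)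
    (hv : Connects G s t {b, c, v}) (hv' : Connects G s t {b, c, v'}) : v = v' := by
  by_contra hne
  have hsupp := h.minimal.support_subset_of_delayed_fork h.adj_left.ne' (h.left_ne h.adj_left) hcs
    hct hcb h.adj_mate.ne hcx hvx hvx' hne h.connects_mate hv hv'
  exact h.not_support_subset (T := {b, x, c, v, v'}) (Finset.card_le_five.trans_lt hw)
    (by simpa using hsupp)

theorem right_unique_of_centre (h : IsTightBorder G s t b x) (hw : 5 < weight s t)
    (hc : IsCentre G s t c) (hy : G.Adj t y) (hy' : G.Adj t y') (hyx : y ≠ x) (hyx' : y' ≠ x)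
    (hcy : G.Adj c y) (hcy' : G.Adj c y') : y = y' := by
  have hbc := h.adj_centre c hc
  have hconn : ∀ z, G.Adj t z → G.Adj c z → Connects G s t {b, c, z} := fun z hz hcz =>
    connects_of_walk (.cons h.adj_left (.cons hbc (.cons hcz (.cons hz.symm .nil)))) (by simp)
  exact h.eq_of_delayed_fork hw hc.1 hc.2.1 hbc.ne' (by rintro rfl; exact hc.2.2.2 h.mate_adj)
    hyx hyx' (hconn y hy hcy) (hconn y' hy' hcy')

theorem subsingleton_privateNeighbors_of_right (h : IsTightBorder G s t b x) (hw : 5 < weight s t)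
    (hy : G.Adj t y) (hyx : y ≠ x) : (privateNeighbors G y t).Subsingleton := by
  have hconn : ∀ v ∈ privateNeighbors G y t, Connects G s t {b, y, v} := by
    rintro v ⟨hyv, hvt, htv⟩
    by_cases hsv : G.Adj s v
    · exact connects_of_walk (.cons hsv (.cons hyv.symm (.cons hy.symm .nil))) (by simp)
    have hvs : v ≠ s := by
      rintro rfl
      exact h.not_adj_right_of_adj_left (by omega) hyv.symm hy
    have hbv := h.adj_centre v ⟨hvs, hvt, hsv, htv⟩
    exact connects_of_walk (.cons h.adj_left (.cons hbv (.cons hyv.symm (.cons hy.symm .nil))))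
      (by simp)
  have hyb : y ≠ b := by
    rintro rfl
    exact h.not_adj_right_of_adj_left (by omega) h.adj_left hy
  intro v hv v' hv'
  exact h.eq_of_delayed_fork hw (h.right_ne hy) hy.ne' hyb hyx
    (by rintro rfl; exact hv.2.2 h.mate_adj) (by rintro rfl; exact hv'.2.2 h.mate_adj)
    (hconn v hv) (hconn v' hv')

theorem adj_right_of_mem_privateNeighbors_of_left (h : IsTightBorder G s t b x)
    (hw : 1 < weight s t) (hm : IsWinningMove G s t (fun _ => none) m) (hmab : m = a ∨ m = b)
    (ha : G.Adj s a) (hab : a ≠ b) (hv : v ∈ privateNeighbors G a s) : G.Adj t v := by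
  obtain ⟨hav, hvs, hsv⟩ := hv
  by_contra htv
  refine h.not_adj_centre_of_left hm hmab ha hab ⟨hvs, ?_, hsv, htv⟩ hav
  rintro rfl
  exact h.not_adj_right_of_adj_left hw ha hav.symm

theorem subsingleton_privateNeighbors_of_left (h : IsTightBorder G s t b x) (hw : 3 < weight s t)
    (hm : IsWinningMove G s t (fun _ => none) m) (hmab : m = a ∨ m = b) (ha : G.Adj s a)
    (hab : a ≠ b) : (privateNeighbors G a s).Subsingleton := fun _ hv _ hv' =>
  h.right_unique_of_left hw ha
    (h.adj_right_of_mem_privateNeighbors_of_left (by omega) hm hmab ha hab hv)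
    (h.adj_right_of_mem_privateNeighbors_of_left (by omega) hm hmab ha hab hv') hv.1 hv'.1

theorem not_subsingleton_privateNeighbors (h : IsTightBorder G s t b x) (hw : 1 < weight s t)
    (hm : IsWinningMove G s t (fun _ => none) m) (hr : r = s ∨ r = t)
    (hplay : ∀ v ∈ privateNeighbors G m r, v ≠ s ∧ v ≠ t) :
    ¬ (privateNeighbors G m r).Subsingleton := by
  intro huniq
  obtain ⟨u, hum, hu⟩ :=
    exists_nonterminal_notMem (T := {m}) (by simpa using hw)
  exact h.not_winsFirst_induce_compl hm.1.1 hm.1.2.1 <|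
    hm.forces_induce_compl ⟨u, by simpa using hum, hu.1, hu.2, rfl⟩ (hr.imp id .inl)
      (fun v hv => ⟨(hplay v hv).1, (hplay v hv).2, rfl⟩) huniq

theorem not_isWinningMove_left (h : IsTightBorder G s t b x) (hw : 3 < weight s t) (ha : G.Adj s a)
    (hab : a ≠ b) : ¬ IsWinningMove G s t (fun _ => none) a := fun hm =>
  h.not_subsingleton_privateNeighbors (by omega) hm (.inl rfl)
    (fun _ hv => ⟨hv.2.1,
      (h.adj_right_of_mem_privateNeighbors_of_left (by omega) hm (.inl rfl) ha hab hv).ne'⟩)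
    (h.subsingleton_privateNeighbors_of_left hw hm (.inl rfl) ha hab)

theorem not_isWinningMove_centre (h : IsTightBorder G s t b x) (hw : 5 < weight s t)
    (hc : IsCentre G s t c) : ¬ IsWinningMove G s t (fun _ => none) c := by
  intro hm
  have hbc := h.adj_centre c hc
  have hmate : ¬ G.Adj c x := fun hcx =>
    h.minimal.not_adj_of_common_neighbor hm (.inr (.inr rfl)) hbc.symm hcx h.adj_mate
  have hright : ∀ v ∈ privateNeighbors G c s, G.Adj t v := by
    rintro v ⟨hcv, hvs, hsv⟩
    by_contra htv
    refine h.minimal.not_adj_of_common_neighbor hm (.inr (.inr rfl)) hbc.symm hcv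
      (h.adj_centre v ⟨hvs, ?_, hsv, htv⟩)
    rintro rfl
    exact hc.2.2.2 hcv.symm
  refine h.not_subsingleton_privateNeighbors (by omega) hm (.inl rfl)
    (fun v hv => ⟨hv.2.1, (hright v hv).ne'⟩) fun v hv v' hv' =>
      h.right_unique_of_centre hw hc (hright v hv) (hright v' hv') ?_ ?_ hv.1 hv'.1
  · rintro rfl
    exact hmate hv.1
  · rintro rfl
    exact hmate hv'.1

theorem ne_left_of_mem_privateNeighbors_of_right (h : IsTightBorder G s t b x) (hw : 1 < weight s t)
    (hy : G.Adj t y) (hv : v ∈ privateNeighbors G y t) : v ≠ s := by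
  rintro rfl
  exact h.not_adj_right_of_adj_left hw hv.1.symm hy

theorem not_isWinningMove_right (h : IsTightBorder G s t b x) (hw : 5 < weight s t) (hy : G.Adj t y)
    (hyx : y ≠ x) : ¬ IsWinningMove G s t (fun _ => none) y := fun hm =>
  h.not_subsingleton_privateNeighbors (by omega) hm (.inr rfl)
    (fun _ hv => ⟨h.ne_left_of_mem_privateNeighbors_of_right (by omega) hy hv, hv.2.1⟩)
    (h.subsingleton_privateNeighbors_of_right hw hy hyx)

theorem not_isWinningMove_mate (h : IsTightBorder G s t b x) (hw : 3 < weight s t) :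
    ¬ IsWinningMove G s t (fun _ => none) x := by
  intro hm
  have hne : ∀ v ∈ privateNeighbors G x t, v ≠ s :=
    fun _ => h.ne_left_of_mem_privateNeighbors_of_right (by omega) h.mate_adj
  have hleft : ∀ v ∈ privateNeighbors G x t, G.Adj s v := by
    intro v hv
    by_contra hsv
    exact h.minimal.not_adj_of_common_neighbor hm (.inr (.inr rfl)) h.adj_mate.symm hv.1
      (h.adj_centre v ⟨hne v hv, hv.2.1, hsv, hv.2.2⟩)
  exact h.not_subsingleton_privateNeighbors (by omega) hm (.inr rfl)
    (fun v hv => ⟨hne v hv, hv.2.1⟩)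
    fun v hv v' hv' => h.left_unique_of_right hw h.mate_adj (hleft v hv) (hleft v' hv') hv.1 hv'.1

theorem not_subsingleton_privateNeighbors_forcedPosition (h : IsTightBorder G s t b x)
    (hw : 3 < weight s t) (hm : IsWinningMove G s t (forcedPosition b x) m)
    (hr : r ∈ usable s t (forcedPosition b x))
    (hplay : ∀ v ∈ privateNeighbors G m r, Playable s t (forcedPosition b x) v) : ¬
    (privateNeighbors G m r).Subsingleton := by
  intro huniq
  obtain ⟨hms, hmt, hcm⟩ := hm.1
  obtain ⟨hmx, hmb⟩ := forcedPosition_eq_none.1 hcm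
  obtain ⟨u, huT, hus, hut⟩ := exists_nonterminal_notMem (T := {b, x, m})
    (Finset.card_le_three.trans_lt hw)
  simp only [Finset.mem_insert, Finset.mem_singleton, not_or] at huT
  obtain ⟨hub, hux, hum⟩ := huT
  have hforces := hm.forces_induce_compl
    ⟨u, hum, hus, hut, forcedPosition_eq_none.2 ⟨hux, hub⟩⟩ hr hplay huniq
  refine h.not_winsFirst_induce_compl hms hmt (winsFirst_of_forces_forcedPosition h.adj_left.ne'
    (h.left_ne h.adj_left) h.adj_mate.ne (h.connects_mate.induce ?_) hforces)
  simp only [Set.insert_subset_iff, Set.singleton_subset_iff, Set.mem_compl_singleton_iff]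
  exact ⟨hms.symm, hmt.symm, hmb.symm, hmx.symm⟩

theorem not_isWinningMove_forcedPosition_left (h : IsTightBorder G s t b x) (hw : 3 < weight s t)
    (hb : IsWinningMove G s t (fun _ => none) b) (ha : G.Adj s a) :
    ¬ IsWinningMove G s t (forcedPosition b x) a := by
  intro hm
  obtain ⟨hax, hab⟩ := forcedPosition_eq_none.1 hm.1.2.2
  have hright : ∀ v ∈ privateNeighbors G a s, G.Adj t v := fun _ =>
    h.adj_right_of_mem_privateNeighbors_of_left (by omega) hb (.inr rfl) ha hab
  refine h.not_subsingleton_privateNeighbors_forcedPosition hw hm (.inl rfl) ?_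
    (h.subsingleton_privateNeighbors_of_left hw hb (.inr rfl) ha hab)
  intro v hv
  refine ⟨hv.2.1, (hright v hv).ne', forcedPosition_eq_none.2 ⟨?_, ?_⟩⟩
  · rintro rfl
    exact hab (h.left_unique_of_right hw h.mate_adj ha h.adj_left hv.1.symm h.adj_mate.symm)
  · rintro rfl
    exact hv.2.2 h.adj_left

theorem not_isWinningMove_forcedPosition_right (h : IsTightBorder G s t b x) (hw : 5 < weight s t)
    (hy : G.Adj t y) : ¬ IsWinningMove G s t (forcedPosition b x) y := by
  intro hm
  obtain ⟨hyx, hyb⟩ := forcedPosition_eq_none.1 hm.1.2.2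
  refine h.not_subsingleton_privateNeighbors_forcedPosition (by omega) hm (.inr (.inl rfl)) ?_
    (h.subsingleton_privateNeighbors_of_right hw hy hyx)
  intro v hv
  refine ⟨h.ne_left_of_mem_privateNeighbors_of_right (by omega) hy hv, hv.2.1,
    forcedPosition_eq_none.2 ⟨?_, ?_⟩⟩
  · rintro rfl
    exact hv.2.2 h.mate_adj
  · rintro rfl
    exact hyx (h.right_unique_of_left (by omega) h.adj_left hy h.mate_adj hv.1.symm h.adj_mate)

theorem not_isWinningMove_forcedPosition_centre (h : IsTightBorder G s t b x) (hw : 5 < weight s t)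
    (hb : IsWinningMove G s t (fun _ => none) b) (hc : IsCentre G s t c) :
    ¬ IsWinningMove G s t (forcedPosition b x) c := by
  intro hm
  have hright : ∀ v ∈ privateNeighbors G c b, G.Adj t v ∧ v ≠ x := by
    rintro v ⟨hcv, hvb, hbv⟩
    refine ⟨?_, by rintro rfl; exact hbv h.adj_mate⟩
    by_contra htv
    have hvs : v ≠ s := by rintro rfl; exact hc.2.2.1 hcv.symm
    have hvt : v ≠ t := by rintro rfl; exact hc.2.2.2 hcv.symm
    have hsv : ¬ G.Adj s v := fun hsv =>
      h.not_adj_centre_of_left hb (.inr rfl) hsv hvb hc hcv.symm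
    exact hbv (h.adj_centre v ⟨hvs, hvt, hsv, htv⟩)
  refine h.not_subsingleton_privateNeighbors_forcedPosition (by omega) hm
    (.inr (.inr (forcedPosition_eq_short.2 ⟨rfl, h.adj_mate.ne⟩))) ?_ ?_
  · intro v hv
    obtain ⟨htv, hvx⟩ := hright v hv
    exact ⟨h.right_ne htv, htv.ne', forcedPosition_eq_none.2 ⟨hvx, hv.2.1⟩⟩
  · intro v hv v' hv'
    exact h.right_unique_of_centre hw hc (hright v hv).1 (hright v' hv').1 (hright v hv).2
      (hright v' hv').2 hv.1 hv'.1

theorem not_isWinningMove_border (h : IsTightBorder G s t b x) (hw : 5 < weight s t) :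
    ¬ IsWinningMove G s t (fun _ => none) b := by
  intro hb
  have hforces : Forces G s t .short .short (forcedPosition b x) :=
    hb.2.reply ⟨h.right_ne h.mate_adj, h.mate_adj.ne', by simp [h.adj_mate.ne']⟩
  obtain ⟨u, huT, hus, hut⟩ := exists_nonterminal_notMem (s := s) (t := t) (T := {b, x})
    (Finset.card_le_two.trans_lt (by omega))
  simp only [Finset.mem_insert, Finset.mem_singleton, not_or] at huT
  obtain ⟨m, hm⟩ := hforces.exists_isWinningMove
    ⟨u, hus, hut, forcedPosition_eq_none.2 huT.symm⟩
  by_cases hsm : G.Adj s m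
  · exact h.not_isWinningMove_forcedPosition_left (by omega) hb hsm hm
  by_cases htm : G.Adj t m
  · exact h.not_isWinningMove_forcedPosition_right hw htm hm
  · exact h.not_isWinningMove_forcedPosition_centre hw hb ⟨hm.1.1, hm.1.2.1, hsm, htm⟩ hm

theorem weight_le_five (h : IsTightBorder G s t b x) : weight s t ≤ 5 := by
  by_contra! hw
  obtain ⟨m, hm⟩ := h.minimal.exists_isWinningMove h.adj_left.ne' (h.left_ne h.adj_left)
  obtain rfl | hmb := eq_or_ne m b
  · exact h.not_isWinningMove_border hw hm
  obtain rfl | hmx := eq_or_ne m x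
  · exact h.not_isWinningMove_mate (by omega) hm
  by_cases hsm : G.Adj s m
  · exact h.not_isWinningMove_left (by omega) hsm hmb hm
  by_cases htm : G.Adj t m
  · exact h.not_isWinningMove_right hw htm hmx hm
  · exact h.not_isWinningMove_centre hw ⟨hm.1.1, hm.1.2.1, hsm, htm⟩ hm

end IsTightBorder

end TightBorder

section DegreeBound

variable [Fintype V] {b x y y' : V}

theorem degree_le_card_of_forall_adj_mem [DecidableRel G.Adj] {T : Finset V}
    (hT : ∀ v, G.Adj b v → v ∈ T) : G.degree b ≤ T.card :=
  Finset.card_le_card fun v hv => hT v ((G.mem_neighborFinset b v).1 hv)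

variable [DecidableEq V]

theorem weight_comm : weight s t = weight t s := by
  unfold weight
  congr 1
  ext v
  simp only [Finset.mem_filter, and_comm]

variable [DecidableRel G.Adj]

theorem centreSize_comm : centreSize G s t = centreSize G t s := by
  unfold centreSize
  congr 1
  ext v
  simp only [Finset.mem_filter, Finset.mem_univ, true_and]
  tauto

theorem weight_le_card_add_centreSize {T : Finset V}
    (hT : G.support ⊆ insert s (insert t (T : Set V))) :
    weight s t ≤ T.card + centreSize G s t := by
  refine (Finset.card_le_card fun v hv => ?_).trans (Finset.card_union_le T _)
  obtain ⟨hvs, hvt⟩ := (Finset.mem_filter.1 hv).2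
  by_cases hvT : v ∈ T
  · exact Finset.mem_union_left _ hvT
  have hsupp : v ∉ G.support := fun h => (hT h).elim hvs fun h => h.elim hvt hvT
  exact Finset.mem_union_right _ <| Finset.mem_filter.2 ⟨Finset.mem_univ v, hvs, hvt,
    fun h => hsupp ⟨s, h.symm⟩, fun h => hsupp ⟨t, h.symm⟩⟩

namespace IsMinimalWeakLink

theorem degree_le_of_adj_of_adj (hG : IsMinimalWeakLink G s t) (hsb : G.Adj s b)
    (htb : G.Adj t b) :
    G.degree b ≤ 2 ∧ weight s t ≤ centreSize G s t + 1 := by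
  have hsupp := hG.support_subset_of_adj_of_adj hsb htb
  constructor
  · refine (degree_le_card_of_forall_adj_mem (T := {s, t}) fun v hv => ?_).trans
      Finset.card_le_two
    simpa [hv.ne'] using hsupp ⟨b, hv.symm⟩
  · have hw := weight_le_card_add_centreSize (T := {b}) (by simpa using hsupp)
    rwa [Finset.card_singleton, add_comm] at hw

theorem degree_le_of_fork (hG : IsMinimalWeakLink G s t) (hsb : G.Adj s b) (htb : ¬ G.Adj t b)
    (hyy' : y ≠ y') (hby : G.Adj b y) (hby' : G.Adj b y') (hty : G.Adj t y)
    (hty' : G.Adj t y') :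
    G.degree b ≤ 3 ∧ weight s t ≤ centreSize G s t + 3 := by
  have hconn : ∀ z, G.Adj b z → G.Adj t z → Connects G s t {b, z} := fun z hbz htz =>
    connects_of_walk (.cons hsb (.cons hbz (.cons htz.symm .nil))) (by simp)
  have hsupp := hG.support_subset_of_fork hsb.ne' (hG.ne_of_adj hsb) hyy' (hconn y hby hty)
    (hconn y' hby' hty')
  constructor
  · refine (degree_le_card_of_forall_adj_mem (T := {s, y, y'}) fun v hv => ?_).trans
      Finset.card_le_three
    have hvt : v ≠ t := by
      rintro rfl
      exact htb hv.symm
    simpa [hv.ne', hvt] using hsupp ⟨b, hv.symm⟩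
  · have hw := weight_le_card_add_centreSize (T := {b, y, y'}) (by simpa using hsupp)
    have hcard : ({b, y, y'} : Finset V).card ≤ 3 := Finset.card_le_three
    omega

theorem degree_le_of_no_mate (hG : IsMinimalWeakLink G s t) (hsb : G.Adj s b)
    (htb : ¬ G.Adj t b) (hmate : ∀ v, G.Adj b v → ¬ G.Adj t v) :
    G.degree b ≤ centreSize G s t + 1 := by
  refine (degree_le_card_of_forall_adj_mem fun v hv => ?_).trans (Finset.card_insert_le s _)
  refine Finset.mem_insert.2 (or_iff_not_imp_left.2 fun hvs => Finset.mem_filter.2 ?_)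
  exact ⟨Finset.mem_univ v, hG.isCentre_of_adj hsb htb hv hvs (hmate v hv)⟩

theorem degree_le_of_unique_mate (hG : IsMinimalWeakLink G s t) (hsb : G.Adj s b)
    (htb : ¬ G.Adj t b) (hbx : G.Adj b x) (htx : G.Adj t x)
    (huniq : ∀ v, G.Adj b v → G.Adj t v → v = x) :
    G.degree b ≤ centreSize G s t + 2 ∧ (5 < weight s t → G.degree b ≤ centreSize G s t + 1) := by
  set C := Finset.univ.filter fun v : V => v ≠ s ∧ v ≠ t ∧ ¬ G.Adj s v ∧ ¬ G.Adj t v with hC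
  have hmemC : ∀ v, v ∈ C ↔ IsCentre G s t v := by simp [hC, IsCentre]
  have hadj : ∀ v, G.Adj b v → v = s ∨ v = x ∨ v ∈ C := by
    intro v hbv
    by_contra! hv
    refine hv.2.2 ((hmemC v).2 (hG.isCentre_of_adj hsb htb hbv hv.1 fun htv => ?_))
    exact hv.2.1 (huniq v hbv htv)
  have hcard : ∀ D : Finset V, (insert s (insert x D)).card ≤ D.card + 2 := fun D =>
    (Finset.card_insert_le s _).trans (Nat.succ_le_succ (Finset.card_insert_le x D))
  refine ⟨(degree_le_card_of_forall_adj_mem fun v hv => ?_).trans (hcard C), fun hw => ?_⟩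
  · simpa only [Finset.mem_insert] using hadj v hv
  obtain ⟨u, huC, hbu⟩ : ∃ u ∈ C, ¬ G.Adj b u := by
    by_contra! hall
    have htight : IsTightBorder G s t b x :=
      ⟨hG, hsb, hbx, htx, fun v hv => hall v ((hmemC v).2 hv)⟩
    exact hw.not_ge htight.weight_le_five
  calc G.degree b
    _ ≤ (insert s (insert x (C.erase u))).card :=
      degree_le_card_of_forall_adj_mem fun v hv => by
        have hvu : v ≠ u := by
          rintro rfl
          exact hbu hv
        simpa [hvu] using hadj v hv
    _ ≤ (C.erase u).card + 2 := hcard _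
    _ = C.card + 1 := by rw [← Finset.card_erase_add_one huC]

theorem degree_le_of_adj_left (hG : IsMinimalWeakLink G s t) (hsb : G.Adj s b) :
    (3 < weight s t → G.degree b ≤ centreSize G s t + 2) ∧
      (5 < weight s t → G.degree b ≤ centreSize G s t + 1) := by
  by_cases htb : G.Adj t b
  · have := hG.degree_le_of_adj_of_adj hsb htb
    omega
  by_cases hmate : ∃ x, G.Adj b x ∧ G.Adj t x
  swap
  · push Not at hmate
    have := hG.degree_le_of_no_mate hsb htb hmate
    omega
  obtain ⟨x, hbx, htx⟩ := hmate
  by_cases huniq : ∀ v, G.Adj b v → G.Adj t v → v = x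
  · have := hG.degree_le_of_unique_mate hsb htb hbx htx huniq
    exact ⟨fun _ => this.1, this.2⟩
  · push Not at huniq
    obtain ⟨y, hby, hty, hyx⟩ := huniq
    have := hG.degree_le_of_fork hsb htb hyx hby hbx hty htx
    omega

end IsMinimalWeakLink

end DegreeBound

end ShannonGame

theorem mainTheorem3 {V : Type*} [Fintype V] [DecidableEq V] (G : SimpleGraph V)
    [DecidableRel G.Adj] (s t : V) (hst : s ≠ t)
    (hG : ShannonGame.IsMinimalWeakLink G s t) (b : V) (hb : ShannonGame.IsBorder G s t b) :
    (3 < ShannonGame.weight s t → G.degree b ≤ ShannonGame.centreSize G s t + 2) ∧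
      (5 < ShannonGame.weight s t → G.degree b ≤ ShannonGame.centreSize G s t + 1) := by
  rcases hb with hsb | htb
  · exact hG.degree_le_of_adj_left hsb
  · rw [ShannonGame.weight_comm, ShannonGame.centreSize_comm]
    exact hG.swap.degree_le_of_adj_left htb
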